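/- Let $N\ge K\ge 1$ and $K/2\le L\le K$ be integers. In the $(N,K,L)$ multi-access cache-aided content delivery network a server holds $N$ files of $F$ bits each (one unit $=F$ bits). There are $K$ caches of $M\ge 0$ units each and $K$ users; user $k$ has access to the $L$ cyclically consecutive caches $k,k+1,\dots,k+L-1$ (indices modulo $K$). In the placement phase, before the requests are known, each cache stores at most $MF$ bits of the files, without coding (uncoded placement). Then each user $k$ requests one file $d_k$, and, depending on $\mathbf d=(d_1,\dots,d_K)\in\{1,\dots,N\}^K$ and on the cache contents, the server broadcasts to all users a message, which may be coded, such that each user recovers its requested file without error from the message and the contents of the $L$ caches it has access to. The pair $(R,M)$ is achievable if for every $\varepsilon>0$ and all sufficiently large $F$ there is an uncoded placement for which every request profile $\mathbf d$ can be served with a message of at most $(R+\varepsilon)F$ bits. Let $R^*(M)$ be the smallest $R$ such that $(R,M)$ is achievable. Then for every $M\ge 0$ $$R^*(M)\;\le\; R_{ub}(M)=\begin{cases} K-\Big[K-\dfrac{(K-L)^2}{K}\Big]\dfrac{MK}{N} & \text{if } 0\le M\le \dfrac NK,\\[2mm] \dfrac{(K-L)^2}{K}\Big(2-\dfrac{MK}{N}\Big)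 & \text{if } \dfrac NK\le M\le \dfrac{2N}{K},\\[2mm] 0 & \text{if } M\ge \dfrac{2N}{K}.\end{cases}$$ -/

import Mathlib

open Filter

/-- The contents of a library of `N` files of `F` bits each. -/
abbrev Library (N F : ℕ) : Type := Fin N → Fin F → Bool

/-- An uncoded placement: each of the `K` caches stores a set of bits of the library, where
`(n, b)` stands for bit `b` of file `n`. It does not depend on the requests. -/
abbrev UncodedPlacement (N K F : ℕ) : Type := Fin K → Finset (Fin N × Fin F)

/-- The `L` cyclically consecutive caches `k, k + 1, …, k + L - 1` (modulo `K`) that user `k`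
has access to. -/
def accessibleCaches (K L : ℕ) (k : Fin K) : Finset (Fin K) :=
  Finset.univ.filter fun c => ∃ i < L, (c : ℕ) = ((k : ℕ) + i) % K

/-- The bits of the library that user `k` can read in the caches it has access to. -/
def availableBits {N K F : ℕ} (L : ℕ) (Z : UncodedPlacement N K F) (k : Fin K) :
    Finset (Fin N × Fin F) :=
  (accessibleCaches K L k).biUnion Z

/-- The values of the bits that user `k` can read in the caches it has access to. -/
def sideInfo {N K F : ℕ} (L : ℕ) (Z : UncodedPlacement N K F) (k : Fin K) (W : Library N F) :
    {p : Fin N × Fin F // p ∈ availableBits L Z k} → Bool :=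
  fun p => W p.1.1 p.1.2

/-- A (possibly coded) delivery scheme for the placement `Z` and the request profile `d` with a
broadcast message of `ℓ` bits: every user `k` recovers the file `d k` without error from the
broadcast message and the caches it has access to. -/
structure DeliveryScheme {N K F : ℕ} (L : ℕ) (Z : UncodedPlacement N K F) (d : Fin K → Fin N)
    (ℓ : ℕ) where
  encode : Library N F → (Fin ℓ → Bool)
  decode : (k : Fin K) → (Fin ℓ → Bool) →
    ({p : Fin N × Fin F // p ∈ availableBits L Z k} → Bool) → (Fin F → Bool)
  correct : ∀ (W : Library N F) (k : Fin K), decode k (encode W) (sideInfo L Z k W) = W (d k)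

/-- With files of `F` bits, there is an uncoded placement that fits into caches of `M` units
(`M * F` bits) and that allows to serve every request profile with a broadcast message of at most
`R` units (`R * F` bits). -/
def HasScheme (N K L F : ℕ) (R M : ℝ) : Prop :=
  ∃ Z : UncodedPlacement N K F, (∀ c, ((Z c).card : ℝ) ≤ M * F) ∧
    ∀ d : Fin K → Fin N, ∃ ℓ : ℕ, (ℓ : ℝ) ≤ R * F ∧ Nonempty (DeliveryScheme L Z d ℓ)

/-- The rate-memory pair `(R, M)` is achievable with uncoded placement: in the limit of large file
size, caches of `M` units suffice for transmission rates arbitrarily close to `R`. -/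
def Achievable (N K L : ℕ) (R M : ℝ) : Prop :=
  ∀ ε : ℝ, 0 < ε → ∀ᶠ F : ℕ in atTop, HasScheme N K L F (R + ε) M

/-- The optimal rate-memory trade-off `R*(M)` under uncoded placement. It is the smallest
achievable rate, see `isLeast_optimalRate`. -/
noncomputable def optimalRate (N K L : ℕ) (M : ℝ) : ℝ :=
  sInf {R : ℝ | Achievable N K L R M}

/-- The piecewise linear function `R_ub(M)`, for `0 ≤ M`. -/
noncomputable def rateUB (N K L : ℕ) (M : ℝ) : ℝ :=
  if M ≤ (N : ℝ) / K then
    (K : ℝ) - ((K : ℝ) - ((K : ℝ) - L) ^ 2 / K) * (M * K / N)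
  else if M ≤ 2 * (N : ℝ) / K then
    ((K : ℝ) - L) ^ 2 / K * (2 - M * K / N)
  else 0

theorem HasScheme.mono {N K L F : ℕ} {R R' M : ℝ} (h : HasScheme N K L F R M) (hR : R ≤ R') :
    HasScheme N K L F R' M := by
  obtain ⟨Z, hZ, hd⟩ := h
  refine ⟨Z, hZ, fun d => ?_⟩
  obtain ⟨ℓ, hl, hs⟩ := hd d
  exact ⟨ℓ, hl.trans (mul_le_mul_of_nonneg_right hR (Nat.cast_nonneg F)), hs⟩

/-- Broadcasting the whole library always works. -/
theorem achievable_card (N K L : ℕ) {M : ℝ} (hM : 0 ≤ M) : Achievable N K L N M := by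
  intro ε hε
  refine Eventually.of_forall fun F => ⟨fun _ => ∅, fun c => ?_, fun d => ⟨N * F, ?_, ⟨?_⟩⟩⟩
  · simpa using mul_nonneg hM (Nat.cast_nonneg F)
  · push_cast
    exact mul_le_mul_of_nonneg_right (by linarith) (Nat.cast_nonneg F)
  · exact
      { encode := fun W i => W (finProdFinEquiv.symm i).1 (finProdFinEquiv.symm i).2
        decode := fun k m _ b => m (finProdFinEquiv (d k, b))
        correct := fun W k => by funext b; simp }

theorem Achievable.nonneg {N K L : ℕ} (hN : 0 < N) {R M : ℝ} (h : Achievable N K L R M) :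
    0 ≤ R := by
  refine le_of_forall_pos_le_add fun ε hε => ?_
  obtain ⟨F, ⟨Z, -, hd⟩, hF⟩ := ((h ε hε).and (eventually_gt_atTop 0)).exists
  obtain ⟨ℓ, hl, -⟩ := hd fun _ => ⟨0, hN⟩
  have hF' : (0 : ℝ) < F := by exact_mod_cast hF
  exact nonneg_of_mul_nonneg_left ((Nat.cast_nonneg ℓ).trans hl) hF'

/-- `R*(M)` is the smallest achievable rate: the infimum that defines it is attained. -/
theorem isLeast_optimalRate (N K L : ℕ) (hN : 0 < N) {M : ℝ} (hM : 0 ≤ M) :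
    IsLeast {R : ℝ | Achievable N K L R M} (optimalRate N K L M) := by
  have hne : {R : ℝ | Achievable N K L R M}.Nonempty := ⟨N, achievable_card N K L hM⟩
  have hbd : BddBelow {R : ℝ | Achievable N K L R M} := ⟨0, fun R hR => hR.nonneg hN⟩
  refine ⟨fun ε hε => ?_, fun R hR => csInf_le hbd hR⟩
  obtain ⟨R, hR, hlt⟩ := Real.lt_sInf_add_pos hne (half_pos hε)
  filter_upwards [hR (ε / 2) (half_pos hε)] with F hF
  refine hF.mono ?_
  change R + ε / 2 ≤ sInf {R : ℝ | Achievable N K L R M} + ε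
  linarith

/-! The bound is piecewise linear, so it suffices to share memory between no caching, storing every
bit once, and storing every bit twice. Two stored copies cost nothing to deliver: `L` consecutive
caches cover `2 * L ≥ K` consecutive positions (`exists_accessibleCaches_double`). With one copy,
each user misses at most `K - L` blocks of its file, one per offset `L + j`. For a fixed offset,
collect one requested block per user; any user misses at most `K - L` of these `K` blocks, so `K -
L` Vandermonde parities suffice. All offsets together cost `(K - L) ^ 2` blocks. -/

/-- A vector supported on at most `m` points that satisfies `m` Vandermonde equations is zero. -/
theorem eq_zero_of_sum_mul_pow_eq_zero {ι E : Type*} [Fintype ι] [Field E] {m : ℕ} {α v : ι → E}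
    (hα : Function.Injective α) (S : Finset ι) (hS : S.card ≤ m) (hv : ∀ k ∉ S, v k = 0)
    (h : ∀ i < m, ∑ k, v k * α k ^ i = 0) : v = 0 := by
  funext k
  by_cases hk : k ∈ S
  · have key := Matrix.eq_zero_of_forall_pow_sum_mul_pow_eq_zero
      (f := fun j => α (S.equivFin.symm j)) (v := fun j => v (S.equivFin.symm j))
      (hα.comp (Subtype.val_injective.comp S.equivFin.symm.injective)) (fun i => by
        have h2 := h i (i.2.trans_le hS)
        rw [← Finset.sum_subset (Finset.subset_univ S) (fun x _ hx => by simp [hv x hx])] at h2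
        rw [← h2, ← Finset.sum_coe_sort S]
        exact Equiv.sum_comp S.equivFin.symm fun x : S => v x * α x ^ (i : ℕ))
    simpa using congrFun key (S.equivFin ⟨k, hk⟩)
  · exact hv k hk

/-! ### Cyclic arithmetic of the caches -/

theorem injective_add_mod (K i : ℕ) :
    Function.Injective fun k : Fin K =>
      (⟨(k + i) % K, Nat.mod_lt _ (Nat.zero_lt_of_lt k.2)⟩ : Fin K) := by
  intro a b h
  have h2 : (a : ℕ) + i ≡ b + i [MOD K] := congrArg Fin.val h
  have h3 := Nat.ModEq.add_right_cancel' i h2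
  exact Fin.ext (Nat.ModEq.eq_of_lt_of_lt h3 a.2 b.2)

theorem le_card_accessibleCaches {K L : ℕ} (hLK : L ≤ K) (k : Fin K) :
    L ≤ (accessibleCaches K L k).card := by
  have hK : 0 < K := Nat.zero_lt_of_lt k.2
  let f : Fin L → Fin K := fun i => ⟨(k + i) % K, Nat.mod_lt _ hK⟩
  have hf : Function.Injective f := by
    intro a b h
    have h2 : (k : ℕ) + a ≡ k + b [MOD K] := congrArg Fin.val h
    have h3 := Nat.ModEq.add_left_cancel' k h2
    exact Fin.ext (Nat.ModEq.eq_of_lt_of_lt h3 (a.2.trans_le hLK) (b.2.trans_le hLK))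
  calc L = (Finset.univ.image f).card := by simp [Finset.card_image_of_injective _ hf]
    _ ≤ _ := Finset.card_le_card fun c hc => by
      obtain ⟨i, -, rfl⟩ := Finset.mem_image.1 hc
      exact Finset.mem_filter.2 ⟨Finset.mem_univ _, i, i.2, rfl⟩

theorem exists_offset {K : ℕ} (k c : Fin K) : ∃ i < K, (c : ℕ) = (k + i) % K := by
  have hK : 0 < K := Nat.zero_lt_of_lt k.2
  refine ⟨(c + (K - k)) % K, Nat.mod_lt _ hK, ?_⟩
  have : (k : ℕ) + (c + (K - k)) = c + K := by omega
  rw [Nat.add_mod_mod, this, Nat.add_mod_right, Nat.mod_eq_of_lt c.2]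

theorem exists_offset_of_notMem_accessibleCaches {K L : ℕ} {k c : Fin K}
    (h : c ∉ accessibleCaches K L k) : ∃ j < K - L, (c : ℕ) = (k + (L + j)) % K := by
  obtain ⟨i, hi, hc⟩ := exists_offset k c
  have hLi : L ≤ i := by
    by_contra hlt
    exact h (Finset.mem_filter.2 ⟨Finset.mem_univ _, i, by omega, hc⟩)
  exact ⟨i - L, by omega, by rw [hc]; congr 2; omega⟩

/-- If cache `c` holds the positions `2 * c` and `2 * c + 1`, then `L ≥ K / 2` consecutive caches
hold all of them. -/
theorem exists_accessibleCaches_double {K L : ℕ} (hL : K ≤ 2 * L) (k p : Fin K) :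
    ∃ c ∈ accessibleCaches K L k, (p : ℕ) = (2 * c) % K ∨ (p : ℕ) = (2 * c + 1) % K := by
  have hK : 0 < K := Nat.zero_lt_of_lt k.2
  -- Position `p` is `2 * k + a` modulo `K`, so it lies in cache `k + a / 2`; here `a < K ≤ 2 * L`
  -- gives `a / 2 < L`.
  obtain ⟨a, ha, hp⟩ := exists_offset ⟨(2 * k) % K, Nat.mod_lt _ hK⟩ p
  have hp : (p : ℕ) = (2 * k + a) % K := by simpa using hp
  refine ⟨⟨(k + a / 2) % K, Nat.mod_lt _ hK⟩,
    Finset.mem_filter.2 ⟨Finset.mem_univ _, a / 2, by omega, rfl⟩, ?_⟩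
  have h1 : 2 * ((k + a / 2) % K) ≡ 2 * (k + a / 2) [MOD K] := (Nat.mod_modEq _ _).mul_left 2
  rcases Nat.even_or_odd' a with ⟨b, rfl | rfl⟩
  · left
    rw [hp]
    have : 2 * (k : ℕ) + 2 * b = 2 * (k + 2 * b / 2) := by omega
    rw [this]
    exact h1.symm
  · right
    rw [hp]
    have : 2 * (k : ℕ) + (2 * b + 1) = 2 * (k + (2 * b + 1) / 2) + 1 := by omega
    rw [this]
    exact (h1.add_right 1).symm

/-! ### Block placement and its delivery -/

/-- A message suffices as soon as, with the side information, it determines the requested file. -/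
theorem nonempty_deliveryScheme_of_determined {N K F L ℓ : ℕ} {Z : UncodedPlacement N K F}
    {d : Fin K → Fin N} {T : Type*} [Fintype T] (hT : Fintype.card T ≤ 2 ^ ℓ)
    (f : Library N F → T)
    (h : ∀ k W W', f W = f W' → sideInfo L Z k W = sideInfo L Z k W' → W (d k) = W' (d k)) :
    Nonempty (DeliveryScheme L Z d ℓ) := by
  classical
  obtain ⟨g⟩ : Nonempty (T ↪ (Fin ℓ → Bool)) :=
    Function.Embedding.nonempty_of_card_le (by simpa using hT)
  refine ⟨⟨fun W => g (f W), fun k y z =>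
    -- Decoding picks any library consistent with the observations; the default is never reached on
    -- an actual transmission.
    if hex : ∃ W, g (f W) = y ∧ sideInfo L Z k W = z then hex.choose (d k) else fun _ => false,
    fun W k => ?_⟩⟩
  have hex : ∃ W', g (f W') = g (f W) ∧ sideInfo L Z k W' = sideInfo L Z k W := ⟨W, rfl, rfl⟩
  rw [dif_pos hex]
  exact h k _ _ (g.injective hex.choose_spec.1) hex.choose_spec.2

theorem eq_of_sideInfo_eq {N K F L : ℕ} {Z : UncodedPlacement N K F} {k : Fin K}
    {W W' : Library N F} (h : sideInfo L Z k W = sideInfo L Z k W') {c : Fin K}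
    (hc : c ∈ accessibleCaches K L k) {p : Fin N × Fin F} (hp : p ∈ Z c) :
    W p.1 p.2 = W' p.1 p.2 :=
  congrFun h ⟨p, Finset.mem_biUnion.2 ⟨c, hc, hp⟩⟩

/-- The positions of the bits of a file that is split into `K` blocks of `s` bits, `K` blocks of
`t` bits and `r` further bits. -/
abbrev BitPosition (K s t r : ℕ) : Type := (Fin K × Fin s) ⊕ (Fin K × Fin t) ⊕ Fin r

/-- Cache `c` stores block `c` of the first kind and blocks `2 * c` and `2 * c + 1` (modulo `K`)
of the second kind of every file. -/
def blockPlacement {N K F s t r : ℕ} (e : BitPosition K s t r ≃ Fin F) :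
    UncodedPlacement N K F := fun c =>
  Finset.univ.image fun q : Fin N × (Fin s ⊕ (Fin t ⊕ Fin t)) =>
    (q.1, e (match q.2 with
      | .inl i => .inl (c, i)
      | .inr (.inl i) => .inr (.inl (⟨(2 * c) % K, Nat.mod_lt _ (Nat.zero_lt_of_lt c.2)⟩, i))
      | .inr (.inr i) =>
        .inr (.inl (⟨(2 * c + 1) % K, Nat.mod_lt _ (Nat.zero_lt_of_lt c.2)⟩, i))))

theorem card_blockPlacement_le {N K F s t r : ℕ} (e : BitPosition K s t r ≃ Fin F) (c : Fin K) :
    (blockPlacement (N := N) e c).card ≤ N * (s + 2 * t) := by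
  refine Finset.card_image_le.trans (le_of_eq ?_)
  simp [Finset.card_univ]
  ring_nf
  simp

theorem mem_blockPlacement_inl {N K F s t r : ℕ} (e : BitPosition K s t r ≃ Fin F) (c : Fin K)
    (n : Fin N) (i : Fin s) : (n, e (.inl (c, i))) ∈ blockPlacement e c :=
  Finset.mem_image.2 ⟨(n, .inl i), Finset.mem_univ _, rfl⟩

theorem exists_mem_blockPlacement_inr {N K L F s t r : ℕ} (hL : K ≤ 2 * L)
    (e : BitPosition K s t r ≃ Fin F) (k p : Fin K) (n : Fin N) (i : Fin t) :
    ∃ c ∈ accessibleCaches K L k, (n, e (.inr (.inl (p, i)))) ∈ blockPlacement e c := by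
  obtain ⟨c, hc, h | h⟩ := exists_accessibleCaches_double hL k p
  · refine ⟨c, hc, Finset.mem_image.2 ⟨(n, .inr (.inl i)), Finset.mem_univ _, ?_⟩⟩
    simp [Fin.ext_iff, h]
  · refine ⟨c, hc, Finset.mem_image.2 ⟨(n, .inr (.inr i)), Finset.mem_univ _, ?_⟩⟩
    simp [Fin.ext_iff, h]

/-- Delivery for the block placement: the bits outside of the caches are sent uncoded, and for each
`j < K - L` one sends `K - L` Vandermonde parities of the blocks `k + L + j` of the requested
files `d k`, of which every user misses at most `K - L`. -/
theorem nonempty_deliveryScheme_blockPlacement {N K L F s t r : ℕ} (hLK : L ≤ K)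
    (hL : K ≤ 2 * L) (hK : 1 ≤ K) (e : BitPosition K s t r ≃ Fin F) (d : Fin K → Fin N) :
    Nonempty (DeliveryScheme L (blockPlacement e) d (K * r + (K - L) * (K - L) * (s + K))) := by
  classical
  have : Fact (Nat.Prime 2) := ⟨Nat.prime_two⟩
  -- The exponent `s` makes room for a block, the extra `K` for `K` distinct evaluation points. The
  -- padding does not grow with `F`.
  let E := GaloisField 2 (s + K)
  have : Fintype E := Fintype.ofFinite E
  have hE : Fintype.card E = 2 ^ (s + K) := by
    rw [← Nat.card_eq_fintype_card]
    exact GaloisField.card 2 (s + K) (by omega)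
  obtain ⟨g⟩ : Nonempty ((Fin s → Bool) ↪ E) :=
    Function.Embedding.nonempty_of_card_le (by
      rw [hE]; simpa using Nat.pow_le_pow_right two_pos (Nat.le_add_right s K))
  obtain ⟨α⟩ : Nonempty (Fin K ↪ E) :=
    Function.Embedding.nonempty_of_card_le (by
      rw [hE, Fintype.card_fin]
      exact K.lt_two_pow_self.le.trans (Nat.pow_le_pow_right two_pos (Nat.le_add_left K s)))
  let pos : ℕ → Fin K → Fin K := fun j k => ⟨(k + (L + j)) % K, Nat.mod_lt _ hK⟩
  let x : Library N F → ℕ → Fin K → E := fun W j k =>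
    g fun i => W (d k) (e (.inl (pos j k, i)))
  let f : Library N F → (Fin K → Fin r → Bool) × (Fin (K - L) → Fin (K - L) → E) := fun W =>
    (fun k i => W (d k) (e (.inr (.inr i))), fun j i => ∑ k, x W j k * α k ^ (i : ℕ))
  refine nonempty_deliveryScheme_of_determined (le_of_eq ?_) f fun k W W' hf hs => ?_
  · simp only [Fintype.card_prod, Fintype.card_fun, Fintype.card_fin, Fintype.card_bool, hE]
    rw [← pow_mul, ← pow_mul, ← pow_mul, ← pow_add]
    congr 1
    ring
  have hfst := congrArg Prod.fst hf
  have hsnd := congrArg Prod.snd hf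
  funext b
  obtain ⟨p, rfl⟩ := e.surjective b
  rcases p with ⟨c, i⟩ | ⟨c, i⟩ | i
  · by_cases hc : c ∈ accessibleCaches K L k
    · exact eq_of_sideInfo_eq hs hc (mem_blockPlacement_inl e c (d k) i)
    obtain ⟨j, hj, hcj⟩ := exists_offset_of_notMem_accessibleCaches hc
    have hpos : pos j k = c := Fin.ext hcj.symm
    -- The difference of the two codewords has zero parities and vanishes wherever user `k` knows
    -- the block.
    have hx : (fun k' => x W j k' - x W' j k') = 0 := by
      refine eq_zero_of_sum_mul_pow_eq_zero (m := K - L) α.injective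
        (Finset.univ.filter fun k' => pos j k' ∉ accessibleCaches K L k) ?_ ?_ ?_
      · have h1 : (Finset.univ.filter fun k' => pos j k' ∉ accessibleCaches K L k).card
            ≤ (accessibleCaches K L k)ᶜ.card :=
          Finset.card_le_card_of_injOn (pos j) (fun a ha => by simpa using ha)
            (injective_add_mod K (L + j)).injOn
        rw [Finset.card_compl, Fintype.card_fin] at h1
        have := le_card_accessibleCaches hLK k
        omega
      · intro k' hk'
        have hk' : pos j k' ∈ accessibleCaches K L k := by simpa using hk'
        refine sub_eq_zero.2 (congrArg g (funext fun i => ?_))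
        exact eq_of_sideInfo_eq hs hk' (mem_blockPlacement_inl e _ (d k') i)
      · intro i hi
        have := congrFun (congrFun hsnd ⟨j, hj⟩) ⟨i, hi⟩
        simp only [sub_mul, Finset.sum_sub_distrib]
        exact sub_eq_zero.2 this
    have h1 := congrFun (g.injective (sub_eq_zero.1 (congrFun hx k))) i
    rwa [hpos] at h1
  · obtain ⟨c', hc', hmem⟩ := exists_mem_blockPlacement_inr hL e k c (d k) i
    exact eq_of_sideInfo_eq hs hc' hmem
  · exact congrFun (congrFun hfst k) i

/-! ### Rates, rounding and memory sharing -/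

theorem hasScheme_of_blocks {N K L F s t r : ℕ} {R M : ℝ} (hLK : L ≤ K) (hL : K ≤ 2 * L)
    (hK : 1 ≤ K) (hF : K * s + K * t + r = F) (hM : (N : ℝ) * (s + 2 * t) ≤ M * F)
    (hR : (K : ℝ) * r + ((K : ℝ) - L) ^ 2 * (s + K) ≤ R * F) : HasScheme N K L F R M := by
  have e : BitPosition K s t r ≃ Fin F := Fintype.equivOfCardEq (by simp; omega)
  refine ⟨blockPlacement e, fun c => le_trans ?_ hM, fun d =>
    ⟨_, le_trans (le_of_eq ?_) hR, nonempty_deliveryScheme_blockPlacement hLK hL hK e d⟩⟩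
  · exact_mod_cast card_blockPlacement_le e c
  · push_cast [Nat.cast_sub hLK]
    ring

/-- Memory sharing: a fraction `K * σ` of each file is stored once, a fraction `K * τ` is stored
twice, and the rest is not cached. -/
theorem achievable_of_fractions {N K L : ℕ} {R M σ τ : ℝ} (hLK : L ≤ K) (hL : K ≤ 2 * L)
    (hK : 1 ≤ K) (hσ : 0 ≤ σ) (hτ : 0 ≤ τ) (hsum : K * (σ + τ) ≤ 1)
    (hM : (N : ℝ) * (σ + 2 * τ) ≤ M)
    (hR : K * (1 - K * (σ + τ)) + ((K : ℝ) - L) ^ 2 * σ ≤ R) : Achievable N K L R M := by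
  intro ε hε
  -- Rounding down `s` and `t` leaves at most `2 * K` extra uncached bits per file, sent for `K`
  -- users; the second term is the field padding. Both must fit in `ε * F`.
  have hlim := tendsto_natCast_atTop_atTop (R := ℝ).eventually_ge_atTop
    ((2 * (K : ℝ) ^ 2 + ((K : ℝ) - L) ^ 2 * K) / ε)
  filter_upwards [hlim] with F hF
  have hF0 : (0 : ℝ) ≤ F := Nat.cast_nonneg F
  have hK0 : (0 : ℝ) ≤ K := Nat.cast_nonneg K
  rw [div_le_iff₀ hε] at hF
  have hs1 := Nat.floor_le (mul_nonneg hσ hF0)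
  have ht1 := Nat.floor_le (mul_nonneg hτ hF0)
  have hs2 := Nat.lt_floor_add_one (σ * F)
  have ht2 := Nat.lt_floor_add_one (τ * F)
  set s := ⌊σ * F⌋₊
  set t := ⌊τ * F⌋₊
  have hle : K * s + K * t ≤ F := by
    have h1 : (K : ℝ) * s + K * t ≤ F := by
      calc (K : ℝ) * s + K * t ≤ K * (σ * F) + K * (τ * F) := by gcongr
        _ = K * (σ + τ) * F := by ring
        _ ≤ 1 * F := by gcongr
        _ = F := one_mul _
    exact_mod_cast h1
  refine hasScheme_of_blocks (s := s) (t := t) (r := F - (K * s + K * t)) hLK hL hK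
    (by omega) ?_ ?_
  · calc (N : ℝ) * (s + 2 * t) ≤ N * (σ * F + 2 * (τ * F)) := by gcongr
      _ = N * (σ + 2 * τ) * F := by ring
      _ ≤ M * F := by gcongr
  · push_cast [Nat.cast_sub hle]
    have h1 : (K : ℝ) * (F - (K * s + K * t))
        ≤ K * (F - (K * (σ * F - 1) + K * (τ * F - 1))) := by
      gcongr <;> linarith
    have h2 : ((K : ℝ) - L) ^ 2 * (s + K) ≤ ((K : ℝ) - L) ^ 2 * (σ * F + K) := by gcongr
    have h3 := mul_le_mul_of_nonneg_right hR hF0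
    linarith

theorem achievable_rateUB {N K L : ℕ} (hK : 1 ≤ K) (hN : K ≤ N) (hLK : L ≤ K)
    (hL : K ≤ 2 * L) {M : ℝ} (hM : 0 ≤ M) : Achievable N K L (rateUB N K L M) M := by
  have hK0 : (0 : ℝ) < K := by exact_mod_cast hK
  have hN0 : (0 : ℝ) < N := by exact_mod_cast hK.trans hN
  unfold rateUB
  split_ifs with h1 h2
  · rw [le_div_iff₀ hK0] at h1
    refine achievable_of_fractions (σ := M / N) (τ := 0) hLK hL hK (by positivity) le_rfl ?_ ?_ ?_
    · rw [add_zero, ← mul_div_assoc, div_le_one hN0]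
      linarith
    · apply le_of_eq
      field_simp
      ring
    · apply le_of_eq
      field_simp
      ring
  · rw [not_le, div_lt_iff₀ hK0] at h1
    rw [le_div_iff₀ hK0] at h2
    -- These solve `K * (σ + τ) = 1` and `N * (σ + 2 * τ) = M`: everything is cached and the memory
    -- is full.
    refine achievable_of_fractions (σ := 2 / K - M / N) (τ := M / N - 1 / K) hLK hL hK ?_ ?_ ?_ ?_ ?_
    · rw [sub_nonneg, div_le_div_iff₀ hN0 hK0]
      exact h2
    · rw [sub_nonneg, div_le_div_iff₀ hK0 hN0]
      linarith
    · apply le_of_eq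
      field_simp
      ring
    · apply le_of_eq
      field_simp
      ring
    · apply le_of_eq
      field_simp
      ring
  · rw [not_le, div_lt_iff₀ hK0] at h2
    refine achievable_of_fractions (σ := 0) (τ := 1 / K) hLK hL hK le_rfl (by positivity) ?_ ?_ ?_
    · apply le_of_eq
      field_simp
      ring
    · have : (N : ℝ) * (0 + 2 * (1 / K)) = 2 * N / K := by ring
      rw [this, div_le_iff₀ hK0]
      exact h2.le
    · apply le_of_eq
      field_simp
      ring

theorem corollary1 (N K L : ℕ) (hK : 1 ≤ K) (hN : K ≤ N) (hLK : L ≤ K)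
    (hL : (K : ℝ) / 2 ≤ (L : ℝ)) (M : ℝ) (hM : 0 ≤ M) :
    optimalRate N K L M ≤ rateUB N K L M := by
  have hL' : K ≤ 2 * L := by
    have : (K : ℝ) ≤ 2 * L := by linarith
    exact_mod_cast this
  exact (isLeast_optimalRate N K L (hK.trans hN) hM).2 (achievable_rateUB hK hN hLK hL' hM)
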